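/- Let $\alpha>2$, $\tau>0$, $\lambda\ge 0$, $\lambda_{I,m}\ge 0$, $\hat P_I\ge 0$, $\hat P_N\ge 0$, and let $\mathcal A\subset\mathbb R^2$ be a Borel set of area $0<|\mathcal A|<\infty$. Let $b\in\mathbb R^2$ be a receiver with polar coordinates $(p_b,\theta_b)$, $p_b\ge 0$. Let the following random objects be independent: a source $i$ located uniformly on $\mathcal A$; its fading gain $h_i\sim\mathrm{Exp}(1)$; a homogeneous Poisson point process $\Phi$ on $\mathbb R^2$ of density $\lambda$ (active IoT devices); a sequence of i.i.d. $\mathrm{Exp}(1)$ fading gains $f_j$ attached to the points $j$ of $\Phi$; a homogeneous Poisson point process $\Phi_{I,m}$ on $\mathbb R^2$ of density $\lambda_{I,m}$ (active incumbent devices on band $m$); and a sequence of i.i.d. $\mathrm{Exp}(1)$ fading gains $g_{j'}$ attached to the points $j'$ of $\Phi_{I,m}$. Write $p_{i,b},p_{j,b},p_{j',b}$ for the distances to $b$, and set $$\mathrm{SINR}_{b,m}=\frac{h_i\,p_{i,b}^{-\alpha}}{\hat P_N+\sum_{j\in\Phi}f_j\,p_{j,b}^{-\alpha}+\sum_{j'\in\Phi_{I,m}}\hat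 P_I\,g_{j'}\,p_{j',b}^{-\alpha}}\in[0,\infty]$$ (which is $+\infty$ if the numerator is positive and the denominator is $0$). Let $$\epsilon_m=\pi\left(\lambda+\hat P_I^{2/\alpha}\lambda_{I,m}\right)\frac{2\pi/\alpha}{\sin(2\pi/\alpha)},\qquad \psi_m=\epsilon_m\,\tau^{2/\alpha}.$$ Then, for negligible noise, that is both for $\hat P_N=0$ and in the limit $\hat P_N\to 0^+$, the average decoding probability at $b$ is $$\Pr\left(\mathrm{SINR}_{b,m}\ge\tau\right)=\int_{\mathcal A}\exp\left(-\psi_m\,p_{i,b}^2\right)\frac{p_i}{|\mathcal A|}\,dp_i\,d\theta_i ,$$ where the integral converges and is taken over the polar coordinates $(p_i,\theta_i)$, $p_i>0$, $-\pi<\theta_i\le\pi$, of the points of $\mathcal A$, and where $p_{i,b}$, the distance between the points with polar coordinates $(p_i,\theta_i)$ and $(p_b,\theta_b)$, satisfies $p_{i,b}^2=p_i^2+p_b^2-2p_ip_b\cos(\theta_i-\theta_b)$. -/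

import Mathlib

open MeasureTheory ProbabilityTheory Filter Topology
open scoped NNReal ENNReal

noncomputable section

/-- The Euclidean plane. -/
abbrev Plane : Type := EuclideanSpace ℝ (Fin 2)

/-- The point of the plane with polar coordinates `(r, θ)`. -/
def polarPoint (r θ : ℝ) : Plane := !₂[r * Real.cos θ, r * Real.sin θ]

/-- The set of polar coordinates `(r, θ)`, `0 < r`, `-π < θ ≤ π`, of the points of `A`
(other than the origin). -/
def polarRegion (A : Set Plane) : Set (ℝ × ℝ) :=
  {q | 0 < q.1 ∧ q.2 ∈ Set.Ioc (-Real.pi) Real.pi ∧ polarPoint q.1 q.2 ∈ A}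

/-- The squared distance of the points with polar coordinates `(r, θ)` and `(r', θ')`, as given by
the law of cosines. -/
def cosineDistSq (r θ r' θ' : ℝ) : ℝ :=
  r ^ 2 + r' ^ 2 - 2 * r * r' * Real.cos (θ - θ')

/-- A finite or infinite sequence of points: `c.1` is the number of points, and the points are
`c.2 j` for `j < c.1` (the values `c.2 j` for `j ≥ c.1` carry no meaning). -/
abbrev PointSeq : Type := ℕ∞ × (ℕ → Plane)

/-- The number of points of `c` that lie in `A`. -/
def PointSeq.count (c : PointSeq) (A : Set Plane) : ℕ∞ :=
  {j : ℕ | (j : ℕ∞) < c.1 ∧ c.2 j ∈ A}.encard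

/-- `Φ` is a homogeneous Poisson point process on the plane with density `lam`: the number of points
in a bounded Borel set `A` is Poisson with mean `lam * |A|`, and the numbers of points in pairwise
disjoint bounded Borel sets are independent. -/
structure IsHPPP {Ω : Type*} [MeasurableSpace Ω] (lam : ℝ≥0) (Φ : Ω → PointSeq) (P : Measure Ω) :
    Prop where
  measurable : Measurable Φ
  hasLaw_count : ∀ A : Set Plane, MeasurableSet A → Bornology.IsBounded A →
    HasLaw (fun ω => (Φ ω).count A)
      ((poissonMeasure (lam * (volume A).toNNReal)).map (fun n : ℕ => (n : ℕ∞))) P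
  iIndepFun_count : ∀ (k : ℕ) (A : Fin k → Set Plane), (∀ i, MeasurableSet (A i)) →
    (∀ i, Bornology.IsBounded (A i)) → Pairwise (fun i j => Disjoint (A i) (A j)) →
    iIndepFun (fun i ω => (Φ ω).count (A i)) P

/-- The fading gains `f 0, f 1, …` are independent and exponentially distributed with mean `1`. -/
structure IsExpFading {Ω : Type*} [MeasurableSpace Ω] (f : Ω → ℕ → ℝ) (P : Measure Ω) : Prop where
  measurable : Measurable f
  hasLaw : ∀ j, HasLaw (fun ω => f ω j) (expMeasure 1) P
  iIndepFun : iIndepFun (fun j ω => f ω j) P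

/-- The power `∑ f_j p_{j,b} ^ (-α)` received at `b` from unit-power transmitters at the points of
`c`, where `p_{j,b}` is the distance of the `j`-th point to `b`. The sum is taken in `[0, ∞]`. -/
def receivedPower (α : ℝ) (b : Plane) (c : PointSeq) (f : ℕ → ℝ) : ℝ≥0∞ :=
  ∑' j : {j : ℕ // (j : ℕ∞) < c.1}, ENNReal.ofReal (f j) * edist (c.2 j) b ^ (-α)

/-- The SINR at `b` of a transmission from `u` with fading gain `h`, with relative noise power `PN`,
active devices `c` with fading gains `f`, and active incumbents `c'` of relative power `PI`
with fading gains `g`. -/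
def sinr (α : ℝ) (PN PI : ℝ≥0) (b u : Plane) (h : ℝ) (c : PointSeq) (f : ℕ → ℝ)
    (c' : PointSeq) (g : ℕ → ℝ) : ℝ≥0∞ :=
  ENNReal.ofReal h * edist u b ^ (-α) /
    (PN + receivedPower α b c f + PI * receivedPower α b c' g)

/-- The average decoding probability `Pr(SINR ≥ τ)` at `b` for a transmitter at the random
location `U`. -/
def adp {Ω : Type*} [MeasurableSpace Ω] (P : Measure Ω) (α τ : ℝ) (PN PI : ℝ≥0) (b : Plane)
    (U : Ω → Plane) (h : Ω → ℝ) (Φ : Ω → PointSeq) (f : Ω → ℕ → ℝ)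
    (ΦI : Ω → PointSeq) (g : Ω → ℕ → ℝ) : ℝ :=
  P.real {ω | ENNReal.ofReal τ ≤ sinr α PN PI b (U ω) (h ω) (Φ ω) (f ω) (ΦI ω) (g ω)}

/-- `ε = π (λ + PI ^ (2/α) λ_I) (2π/α) / sin (2π/α)`. -/
def epsCoeff (α : ℝ) (lam lamI PI : ℝ≥0) : ℝ :=
  Real.pi * ((lam : ℝ) + (PI : ℝ) ^ (2 / α) * (lamI : ℝ)) *
    ((2 * Real.pi / α) / Real.sin (2 * Real.pi / α))

/-- `ψ = ε τ ^ (2/α)`. -/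
def psiCoeff (α τ : ℝ) (lam lamI PI : ℝ≥0) : ℝ :=
  epsCoeff α lam lamI PI * τ ^ (2 / α)

/-- The integrand `exp (-ψ p_{i,b} ^ 2) p_i / |A|` in the polar coordinates `q = (p_i, θ_i)`
of the source, for a receiver with polar coordinates `(pb, θb)`. -/
def adpIntegrand (ψ : ℝ) (A : Set Plane) (pb θb : ℝ) (q : ℝ × ℝ) : ℝ :=
  Real.exp (-ψ * cosineDistSq q.1 q.2 pb θb) * (q.1 / volume.real A)

end

/-! Rayleigh fading turns a decoding probability into a Laplace transform. Fix the source at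
distance `d > 0` from the receiver, fix the total noise and interference `D`, and put `s = τ d^α`.
Decoding means `h ≥ s D`, which has probability `exp (-s D)` because `h` is exponential
(`expMeasure_setOf_le_div`). By independence the mean of `exp (-s D)` splits into a noise factor and
one factor for each Poisson field.

For a field of density `λ`, averaging over the gains first gives `∏ (1 + s r_j^(-α))⁻¹ = exp (-∑ log
(1 + s r_j^(-α)))`. The Laplace functional of the Poisson process (`IsHPPP.lintegral_expNeg`) then
gives `exp (-λ ∫ s / (‖x‖^α + s) dx)`. The integral equals `π s^(2/α) Γ(1 + 2/α) Γ(1 - 2/α)`,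
evaluated by the reflection formula; it is finite because `α > 2`. Since `s^(2/α) = τ^(2/α) d^2`,
and the incumbent field uses `s PI` in place of `s`, the two exponents add up to `ψ d^2`.

It remains to average over the uniform source in polar coordinates and to let the noise factor tend
to `1` by dominated convergence. Working in `[0, ∞]` with `exp (-∞) = 0` removes every question of
whether the interference sums converge. -/

/-! ### Exponential and logarithm on `[0, ∞]` -/

/-- The decreasing exponential `x ↦ exp (-x)` on `[0, ∞]`, with value `0` at `∞`. -/
noncomputable def expNeg (x : ℝ≥0∞) : ℝ≥0∞ := EReal.exp (-(x : EReal))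

lemma continuous_expNeg : Continuous expNeg :=
  ENNReal.continuous_exp.comp (continuous_neg.comp continuous_coe_ennreal_ereal)

lemma measurable_expNeg : Measurable expNeg := continuous_expNeg.measurable

lemma antitone_expNeg : Antitone expNeg := fun _ _ h =>
  EReal.exp_monotone (EReal.neg_le_neg_iff.2 (EReal.coe_ennreal_le_coe_ennreal_iff.2 h))

@[simp] lemma expNeg_zero : expNeg 0 = 1 := by simp [expNeg]

@[simp] lemma expNeg_top : expNeg ⊤ = 0 := by simp [expNeg]

lemma expNeg_ofReal {x : ℝ} (hx : 0 ≤ x) :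
    expNeg (ENNReal.ofReal x) = ENNReal.ofReal (Real.exp (-x)) := by
  rw [expNeg, EReal.coe_ennreal_ofReal, max_eq_left hx, ← EReal.coe_neg, EReal.exp_coe]

lemma expNeg_le_one (x : ℝ≥0∞) : expNeg x ≤ 1 := by
  simpa using antitone_expNeg (zero_le (a := x))

lemma expNeg_ne_top (x : ℝ≥0∞) : expNeg x ≠ ⊤ :=
  ((expNeg_le_one x).trans_lt ENNReal.one_lt_top).ne

lemma expNeg_add (x y : ℝ≥0∞) : expNeg (x + y) = expNeg x * expNeg y := by
  rw [expNeg, EReal.coe_ennreal_add, EReal.neg_add (.inl (by simp)) (.inr (by simp)),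
    sub_eq_add_neg, EReal.exp_add, expNeg, expNeg]

lemma expNeg_sum {ι : Type*} (s : Finset ι) (x : ι → ℝ≥0∞) :
    expNeg (∑ i ∈ s, x i) = ∏ i ∈ s, expNeg (x i) := by
  classical
  induction s using Finset.induction_on with
  | empty => simp
  | insert a s ha ih => rw [Finset.sum_insert ha, Finset.prod_insert ha, expNeg_add, ih]

lemma expNeg_mul_natCast (x : ℝ≥0∞) (n : ℕ) : expNeg (x * n) = expNeg x ^ n := by
  have := expNeg_sum (Finset.range n) (fun _ => x)
  simpa [mul_comm] using this

/-- The function `x ↦ log (1 + x)` on `[0, ∞]`. -/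
noncomputable def logOneAdd (x : ℝ≥0∞) : ℝ≥0∞ := (ENNReal.log (1 + x)).toENNReal

lemma measurable_logOneAdd : Measurable logOneAdd := by
  unfold logOneAdd
  exact (ENNReal.measurable_log.comp (measurable_const.add measurable_id)).ereal_toENNReal

/-- Lets a product of fading factors be written as the exponential of a sum over points, the form to
which a Laplace functional applies. -/
lemma expNeg_logOneAdd (x : ℝ≥0∞) : expNeg (logOneAdd x) = (1 + x)⁻¹ := by
  rw [expNeg, logOneAdd, EReal.coe_toENNReal (ENNReal.zero_le_log_iff.2 le_self_add),
    EReal.exp_neg, ENNReal.exp_log]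

/-! ### Transforms of the Poisson and exponential laws -/

/-- The Poisson probability generating function. -/
lemma lintegral_pow_poissonMeasure (m : ℝ≥0) {z : ℝ≥0∞} (hz : z ≤ 1) :
    ∫⁻ n : ℕ, z ^ n ∂(poissonMeasure m) = expNeg (m * (1 - z)) := by
  lift z to ℝ≥0 using (hz.trans_lt ENNReal.one_lt_top).ne
  have hz' : z ≤ 1 := by exact_mod_cast hz
  rw [lintegral_countable']
  simp_rw [poissonMeasure_singleton]
  have h1 : ∀ n : ℕ, (z : ℝ≥0∞) ^ n * ENNReal.ofReal (Real.exp (-m) * m ^ n / n.factorial) =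
      ENNReal.ofReal (Real.exp (-m) * ((m * z : ℝ) ^ n / n.factorial)) := by
    intro n
    rw [← ENNReal.ofReal_coe_nnreal, ← ENNReal.ofReal_pow (by positivity),
      ← ENNReal.ofReal_mul (by positivity)]
    congr 1
    rw [mul_pow]; ring
  simp_rw [h1]
  have h2 : HasSum (fun n : ℕ => Real.exp (-m) * ((m * z : ℝ) ^ n / n.factorial))
      (Real.exp (-m) * Real.exp (m * z)) := by
    apply HasSum.mul_left
    rw [Real.exp_eq_exp_ℝ]
    exact NormedSpace.expSeries_div_hasSum_exp _
  rw [← ENNReal.ofReal_tsum_of_nonneg (fun n => by positivity) h2.summable, h2.tsum_eq,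
    ← Real.exp_add]
  have h3 : (m : ℝ≥0∞) * (1 - z) = ENNReal.ofReal (m * (1 - z)) := by
    rw [ENNReal.ofReal_mul (by positivity), ENNReal.ofReal_sub _ (by positivity)]
    simp
  rw [h3, expNeg_ofReal (mul_nonneg (by positivity) (sub_nonneg.2 (by exact_mod_cast hz')))]
  congr 2; ring

lemma lintegral_Ioi_exp_neg_mul {c : ℝ} (hc : 0 < c) (a : ℝ) :
    ∫⁻ x in Set.Ioi a, ENNReal.ofReal (Real.exp (-c * x)) =
      ENNReal.ofReal (Real.exp (-c * a) / c) := by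
  rw [← ofReal_integral_eq_lintegral_ofReal (integrableOn_exp_mul_Ioi (neg_neg_of_pos hc) a)
    (Eventually.of_forall fun x => (Real.exp_pos _).le),
    integral_exp_mul_Ioi (neg_neg_of_pos hc), neg_div_neg_eq]

lemma lintegral_expMeasure_one {F : ℝ → ℝ≥0∞} (hF : Measurable F) :
    ∫⁻ x, F x ∂(expMeasure 1) = ∫⁻ x in Set.Ioi 0, ENNReal.ofReal (Real.exp (-x)) * F x := by
  have hpdf : Measurable (exponentialPDF 1) :=
    (measurable_exponentialPDFReal 1).ennreal_ofReal
  change ∫⁻ x, F x ∂(volume.withDensity (exponentialPDF 1)) = _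
  rw [lintegral_withDensity_eq_lintegral_mul _ hpdf hF, ← lintegral_indicator measurableSet_Ioi]
  apply lintegral_congr_ae
  filter_upwards [Measure.ae_ne volume (0 : ℝ)] with x hx
  rcases lt_or_gt_of_ne hx with h | h
  · simp [exponentialPDF_of_neg h, h.le]
  · simp [exponentialPDF_of_nonneg h.le, h]

/-- The Laplace transform of the exponential distribution. -/
lemma lintegral_expNeg_expMeasure (t : ℝ≥0∞) :
    ∫⁻ x, expNeg (ENNReal.ofReal x * t) ∂(expMeasure 1) = (1 + t)⁻¹ := by
  have hm : Measurable fun x => expNeg (ENNReal.ofReal x * t) :=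
    measurable_expNeg.comp (ENNReal.measurable_ofReal.mul_const t)
  rw [lintegral_expMeasure_one hm]
  induction t with
  | top =>
    rw [setLIntegral_congr_fun (g := fun _ => 0) measurableSet_Ioi]
    · simp
    · intro x hx
      simp [ENNReal.mul_top, ENNReal.ofReal_pos.2 hx |>.ne']
  | coe t =>
    rw [setLIntegral_congr_fun (g := fun x => ENNReal.ofReal (Real.exp (-(1 + t) * x)))
      measurableSet_Ioi, lintegral_Ioi_exp_neg_mul (by positivity)]
    · rw [mul_zero, Real.exp_zero, one_div, ENNReal.ofReal_inv_of_pos (by positivity),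
        ENNReal.ofReal_add zero_le_one (by positivity)]
      simp
    · intro x hx
      have hx' : (0 : ℝ) < x := hx
      dsimp only
      rw [← ENNReal.ofReal_coe_nnreal, ← ENNReal.ofReal_mul hx'.le,
        expNeg_ofReal (by positivity), ← ENNReal.ofReal_mul (Real.exp_pos _).le, ← Real.exp_add]
      congr 2; ring

/-- The exponential distribution is carried by the positive reals. -/
lemma expMeasure_setOf_ofReal_eq_zero : expMeasure 1 {x | ENNReal.ofReal x = 0} = 0 := by
  have hm : MeasurableSet {x : ℝ | ENNReal.ofReal x = 0} :=
    ENNReal.measurable_ofReal (measurableSet_singleton 0)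
  rw [← lintegral_indicator_one hm, lintegral_expMeasure_one (measurable_one.indicator hm),
    setLIntegral_congr_fun (g := fun _ => 0) measurableSet_Ioi]
  · simp
  · intro x hx
    have hx' : (0 : ℝ) < x := hx
    simp [hx']

/-- The tail of the exponential distribution. -/
lemma expMeasure_setOf_le_ofReal (s : ℝ≥0∞) :
    expMeasure 1 {x | s ≤ ENNReal.ofReal x} = expNeg s := by
  have hm : MeasurableSet {x : ℝ | s ≤ ENNReal.ofReal x} :=
    ENNReal.measurable_ofReal measurableSet_Ici
  induction s with
  | top => simp
  | coe s =>
    rw [← lintegral_indicator_one hm, lintegral_expMeasure_one (measurable_one.indicator hm)]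
    have h1 : ∀ᵐ x : ℝ, x ∈ Set.Ioi (0 : ℝ) →
        ENNReal.ofReal (Real.exp (-x)) * {x : ℝ | (s : ℝ≥0∞) ≤ ENNReal.ofReal x}.indicator 1 x =
        (Set.Ioi (s : ℝ)).indicator (fun x => ENNReal.ofReal (Real.exp (-1 * x))) x := by
      -- Off the null set `{s}` the closed and open half-lines agree.
      filter_upwards [Measure.ae_ne volume (s : ℝ)] with x hx hx0
      have h2 : (s : ℝ≥0∞) ≤ ENNReal.ofReal x ↔ (s : ℝ) < x := by
        rw [← ENNReal.ofReal_coe_nnreal, ENNReal.ofReal_le_ofReal_iff (le_of_lt hx0)]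
        exact ⟨fun h => lt_of_le_of_ne h (Ne.symm hx), le_of_lt⟩
      by_cases h : (s : ℝ) < x
      · simp [Set.indicator, h2, h]
      · simp [Set.indicator, h2, h]
    rw [setLIntegral_congr_fun_ae measurableSet_Ioi h1, setLIntegral_indicator measurableSet_Ioi,
      Set.Ioi_inter_Ioi, max_eq_left (by positivity), lintegral_Ioi_exp_neg_mul one_pos,
      ← ENNReal.ofReal_coe_nnreal, expNeg_ofReal (by positivity)]
    simp

/-! ### Polar coordinates -/

/-- The volume preserving identification of the plane with `ℝ × ℝ`. -/
noncomputable def planeEquivProd : Plane ≃ᵐ ℝ × ℝ :=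
  (MeasurableEquiv.toLp 2 (Fin 2 → ℝ)).symm.trans MeasurableEquiv.finTwoArrow

lemma measurePreserving_planeEquivProd_symm : MeasurePreserving planeEquivProd.symm :=
  ((volume_preserving_finTwoArrow ℝ).comp
    (EuclideanSpace.volume_preserving_symm_measurableEquiv_toLp (Fin 2))).symm planeEquivProd

/-- The law of cosines. -/
lemma dist_polarPoint_sq (r θ r' θ' : ℝ) :
    dist (polarPoint r θ) (polarPoint r' θ') ^ 2 = cosineDistSq r θ r' θ' := by
  rw [EuclideanSpace.dist_eq, Real.sq_sqrt (by positivity)]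
  simp only [polarPoint, cosineDistSq, Fin.sum_univ_two, Real.dist_eq, sq_abs, Real.cos_sub]
  simp only [Matrix.cons_val_zero, Matrix.cons_val_one]
  linear_combination r ^ 2 * Real.sin_sq_add_cos_sq θ + r' ^ 2 * Real.sin_sq_add_cos_sq θ'

lemma continuous_polarPoint : Continuous fun q : ℝ × ℝ => polarPoint q.1 q.2 := by
  unfold polarPoint
  fun_prop

lemma measurableSet_polarRegion {A : Set Plane} (hA : MeasurableSet A) :
    MeasurableSet (polarRegion A) :=
  (measurable_fst measurableSet_Ioi).inter ((measurable_snd measurableSet_Ioc).inter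
    (continuous_polarPoint.measurable hA))

/-- Integration in polar coordinates. -/
lemma lintegral_eq_polarRegion {A : Set Plane} (hA : MeasurableSet A) {F : Plane → ℝ≥0∞} :
    ∫⁻ x in A, F x =
      ∫⁻ q in polarRegion A, ENNReal.ofReal q.1 * F (polarPoint q.1 q.2) := by
  rw [← lintegral_indicator hA,
    ← measurePreserving_planeEquivProd_symm.lintegral_comp_emb
      planeEquivProd.symm.measurableEmbedding,
    ← lintegral_comp_polarCoord_symm, ← lintegral_indicator (measurableSet_polarRegion hA),
    ← lintegral_indicator polarCoord.open_target.measurableSet]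
  apply lintegral_congr_ae
  -- `polarRegion` admits the angle `π`, while `polarCoord.target` is open and omits it; the
  -- difference is a null set.
  have h : ∀ᵐ q : ℝ × ℝ, q.2 ≠ Real.pi := by
    rw [Measure.volume_eq_prod]
    exact Measure.quasiMeasurePreserving_snd.ae (Measure.ae_ne volume Real.pi)
  filter_upwards [h] with q hq
  have hp : planeEquivProd.symm (polarCoord.symm q) = polarPoint q.1 q.2 := rfl
  have hmem : q ∈ polarRegion A ↔ q ∈ polarCoord.target ∧ polarPoint q.1 q.2 ∈ A := by
    simp only [polarRegion, polarCoord_target, Set.mem_ofPred_eq, Set.mem_prod, Set.mem_Ioi,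
      Set.mem_Ioo, Set.mem_Ioc, and_assoc]
    have : q.2 ≤ Real.pi ↔ q.2 < Real.pi := ⟨fun h => lt_of_le_of_ne h hq, le_of_lt⟩
    rw [this]
  by_cases h1 : q ∈ polarCoord.target <;> by_cases h2 : polarPoint q.1 q.2 ∈ A <;>
    simp only [Set.indicator, hmem, h1, h2, hp, if_true, if_false, and_self, and_true, and_false,
      smul_eq_mul, mul_zero]

/-! ### The path-loss integral -/

/-- Radial integrals over the plane and over `ℂ` agree. -/
lemma lintegral_comp_norm_plane (F : ℝ → ℝ≥0∞) :
    ∫⁻ x : Plane, F ‖x‖ = ∫⁻ z : ℂ, F ‖z‖ := by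
  let e : ℂ ≃ₗᵢ[ℝ] Plane := Complex.orthonormalBasisOneI.repr
  rw [← (e.measurePreserving).lintegral_comp_emb e.toHomeomorph.measurableEmbedding]
  simp

lemma lintegral_exp_neg_mul_norm_rpow {α y : ℝ} (hα : 1 ≤ α) (hy : 0 < y) :
    ∫⁻ x : Plane, ENNReal.ofReal (Real.exp (-y * ‖x‖ ^ α)) =
      ENNReal.ofReal (Real.pi * y ^ (-2 / α) * Real.Gamma (2 / α + 1)) := by
  rw [lintegral_comp_norm_plane (fun r => ENNReal.ofReal (Real.exp (-y * r ^ α))),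
    ← Complex.integral_exp_neg_mul_rpow hα hy, ofReal_integral_eq_lintegral_ofReal]
  -- A non-integrable function would have Bochner integral `0`, but the known value is positive.
  · by_contra h
    have := Complex.integral_exp_neg_mul_rpow hα hy
    rw [integral_undef h] at this
    have h2 : 0 < Real.Gamma (2 / α + 1) := Real.Gamma_pos_of_pos (by positivity)
    have := Real.pi_pos
    have : 0 < Real.pi * y ^ (-2 / α) * Real.Gamma (2 / α + 1) := by positivity
    linarith
  · exact Eventually.of_forall fun x => (Real.exp_pos _).le

/-- The mean interference factor of a unit density of transmitters around the origin. -/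
lemma lintegral_div_norm_rpow_add {α s : ℝ} (hα : 2 < α) (hs : 0 < s) :
    ∫⁻ x : Plane, ENNReal.ofReal (s / (‖x‖ ^ α + s)) =
      ENNReal.ofReal (Real.pi * s ^ (2 / α) *
        ((2 * Real.pi / α) / Real.sin (2 * Real.pi / α))) := by
  have hδ : 2 / α < 1 := by rw [div_lt_one (by linarith)]; exact hα
  -- Writing `1 / c` as `∫ exp (-c y) dy` and applying Tonelli leaves a stretched-exponential
  -- integral in `x` and then a Gamma integral in `y`.
  have h1 : ∀ x : Plane, ENNReal.ofReal (s / (‖x‖ ^ α + s)) =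
      ∫⁻ y in Set.Ioi (0 : ℝ), ENNReal.ofReal (s * Real.exp (-s * y)) *
        ENNReal.ofReal (Real.exp (-y * ‖x‖ ^ α)) := by
    intro x
    have hc : 0 < ‖x‖ ^ α + s := by positivity
    have := lintegral_Ioi_exp_neg_mul hc 0
    rw [mul_zero, Real.exp_zero] at this
    rw [div_eq_mul_one_div, ENNReal.ofReal_mul hs.le, ← this, ← lintegral_const_mul _ (by fun_prop)]
    congr with y
    rw [← ENNReal.ofReal_mul hs.le, ← ENNReal.ofReal_mul (by positivity), mul_assoc,
      ← Real.exp_add]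
    congr 3; ring
  simp_rw [h1]
  rw [lintegral_lintegral_swap (by
    have : Measurable fun p : Plane × ℝ => ‖p.1‖ ^ α := by fun_prop
    fun_prop)]
  have h2 : ∀ y ∈ Set.Ioi (0 : ℝ), (∫⁻ x : Plane, ENNReal.ofReal (s * Real.exp (-s * y)) *
        ENNReal.ofReal (Real.exp (-y * ‖x‖ ^ α))) =
      ENNReal.ofReal (s * Real.pi * Real.Gamma (2 / α + 1) *
        (y ^ ((1 - 2 / α) - 1) * Real.exp (-(s * y)))) := by
    intro y hy
    rw [lintegral_const_mul _ (by fun_prop), lintegral_exp_neg_mul_norm_rpow (by linarith) hy,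
      ← ENNReal.ofReal_mul (by positivity)]
    have : (1 - 2 / α) - 1 = -2 / α := by ring
    rw [this]
    congr 1
    rw [neg_mul]; ring
  rw [setLIntegral_congr_fun measurableSet_Ioi h2]
  have hG : 0 < Real.Gamma (2 / α + 1) := Real.Gamma_pos_of_pos (by positivity)
  have h3 := Real.integral_rpow_mul_exp_neg_mul_Ioi (a := 1 - 2 / α) (by linarith) hs
  -- Integrability is again read off from a nonzero value of the integral; `2 / α < 1` is what
  -- controls the singularity at `0`.
  have hint : IntegrableOn (fun y : ℝ => y ^ ((1 - 2 / α) - 1) * Real.exp (-(s * y)))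
      (Set.Ioi 0) := by
    by_contra h
    rw [integral_undef h] at h3
    have : 0 < Real.Gamma (1 - 2 / α) := Real.Gamma_pos_of_pos (by linarith)
    have : 0 < (1 / s) ^ (1 - 2 / α) * Real.Gamma (1 - 2 / α) := by positivity
    linarith
  rw [← ofReal_integral_eq_lintegral_ofReal (hint.const_mul _), integral_const_mul, h3]
  · congr 1
    -- Euler's reflection formula is the source of the sine in `epsCoeff`.
    have h4 := Real.Gamma_mul_Gamma_one_sub (2 / α)
    have h5 : Real.Gamma (2 / α + 1) = 2 / α * Real.Gamma (2 / α) :=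
      Real.Gamma_add_one (by positivity)
    have h6 : Real.pi * (2 / α) = 2 * Real.pi / α := by ring
    have h7 : (1 / s) ^ (1 - 2 / α) = s ^ (2 / α) / s := by
      rw [one_div, Real.inv_rpow hs.le, ← Real.rpow_neg hs.le, neg_sub, Real.rpow_sub_one hs.ne']
    rw [h6] at h4
    rw [h5, h7]
    calc _ = Real.pi * s ^ (2 / α) * (2 / α) *
          (Real.Gamma (2 / α) * Real.Gamma (1 - 2 / α)) := by field_simp
      _ = _ := by rw [h4]; ring
  · filter_upwards [self_mem_ae_restrict measurableSet_Ioi] with y hy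
    have : (0 : ℝ) < y := hy
    positivity

lemma one_sub_inv_one_add_path_loss {α : ℝ} {s : ℝ} (hs : 0 < s) {x b : Plane}
    (hx : x ≠ b) :
    1 - (1 + ENNReal.ofReal s * edist x b ^ (-α))⁻¹ =
      ENNReal.ofReal (s / (‖x - b‖ ^ α + s)) := by
  have hd : 0 < ‖x - b‖ := norm_pos_iff.2 (sub_ne_zero.2 hx)
  have hp : 0 < ‖x - b‖ ^ α := by positivity
  rw [edist_dist, dist_eq_norm, ENNReal.ofReal_rpow_of_pos hd, ← ENNReal.ofReal_mul hs.le,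
    ← ENNReal.ofReal_one, ← ENNReal.ofReal_add zero_le_one (by positivity),
    ← ENNReal.ofReal_inv_of_pos (by positivity), ← ENNReal.ofReal_sub _ (by positivity),
    Real.rpow_neg hd.le]
  congr 1
  field_simp
  ring

lemma lintegral_one_sub_inv_one_add_path_loss {α : ℝ} (hα : 2 < α) {s : ℝ} (hs : 0 ≤ s)
    (b : Plane) :
    ∫⁻ x : Plane, (1 - (1 + ENNReal.ofReal s * edist x b ^ (-α))⁻¹) =
      ENNReal.ofReal (Real.pi * s ^ (2 / α) *
        ((2 * Real.pi / α) / Real.sin (2 * Real.pi / α))) := by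
  rcases hs.eq_or_lt with rfl | hs
  · have : (0 : ℝ) ^ (2 / α) = 0 := Real.zero_rpow (by positivity)
    simp [this]
  · rw [← lintegral_div_norm_rpow_add hα hs,
      ← lintegral_sub_right_eq_self (fun x : Plane => ENNReal.ofReal (s / (‖x‖ ^ α + s))) b]
    apply lintegral_congr_ae
    filter_upwards [Measure.ae_ne volume b] with x hx
    exact one_sub_inv_one_add_path_loss hs hx

/-! ### The Laplace functional of a Poisson process -/

/-- The counting measure of a sequence of points. -/
noncomputable def PointSeq.toMeasure (c : PointSeq) : Measure Plane :=
  Measure.sum fun j : {j : ℕ // (j : ℕ∞) < c.1} => Measure.dirac (c.2 j)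

lemma PointSeq.lintegral_toMeasure (c : PointSeq) (φ : Plane → ℝ≥0∞) :
    ∫⁻ x, φ x ∂c.toMeasure = ∑' j : {j : ℕ // (j : ℕ∞) < c.1}, φ (c.2 j) := by
  simp [PointSeq.toMeasure, lintegral_sum_measure]

lemma PointSeq.tsum_eq_tsum_ite (c : PointSeq) (φ : ℕ → ℝ≥0∞) :
    ∑' j : {j : ℕ // (j : ℕ∞) < c.1}, φ j = ∑' j : ℕ, if (j : ℕ∞) < c.1 then φ j else 0 := by
  exact (tsum_subtype {j : ℕ | (j : ℕ∞) < c.1} φ).trans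
    (tsum_congr fun j => by simp [Set.indicator])

lemma PointSeq.toMeasure_apply (c : PointSeq) {A : Set Plane} (hA : MeasurableSet A) :
    c.toMeasure A = ((c.count A : ℕ∞) : ℝ≥0∞) := by
  rw [← lintegral_indicator_one hA, c.lintegral_toMeasure,
    c.tsum_eq_tsum_ite (fun j => A.indicator 1 (c.2 j)), PointSeq.count,
    ← ENNReal.tsum_set_one, tsum_subtype _ (fun _ => (1 : ℝ≥0∞))]
  refine tsum_congr fun j => ?_
  by_cases h1 : (j : ℕ∞) < c.1 <;> by_cases h2 : c.2 j ∈ A <;> simp [Set.indicator, h1, h2]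

/-- Since `exp (-y N) = z^N` with `z = exp (-y)`, this is the Poisson generating function at `z`; `y
= ∞` corresponds to `z = 0`. -/
lemma IsHPPP.lintegral_expNeg_mul_count {Ω : Type*} [MeasurableSpace Ω] {P : Measure Ω}
    {lam : ℝ≥0} {Φ : Ω → PointSeq} (hΦ : IsHPPP lam Φ P) {A : Set Plane} (hA : MeasurableSet A)
    (hAb : Bornology.IsBounded A) (y : ℝ≥0∞) :
    ∫⁻ ω, expNeg (y * ((Φ ω).count A : ℕ∞)) ∂P = expNeg (lam * ((1 - expNeg y) * volume A)) := by
  have hm : Measurable fun n : ℕ∞ => expNeg (y * (n : ℝ≥0∞)) := measurable_from_top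
  rw [(hΦ.hasLaw_count A hA hAb).lintegral_comp hm.aemeasurable,
    lintegral_map hm measurable_from_top]
  simp only [ENat.toENNReal_coe, expNeg_mul_natCast]
  rw [lintegral_pow_poissonMeasure _ (expNeg_le_one y), ENNReal.coe_mul,
    ENNReal.coe_toNNReal hAb.measure_lt_top.ne, mul_assoc, mul_comm (volume A)]

/-- The index set varies with `e`, so the sum is extended to all of `ℕ` by a measurable cutoff. -/
lemma measurable_tsum_points {E : Type*} [MeasurableSpace E] {φ : E → ℕ → ℝ≥0∞} {c : E → PointSeq}
    (hφ : ∀ j, Measurable fun e => φ e j) (hc : Measurable c) :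
    Measurable fun e => ∑' j : {j : ℕ // (j : ℕ∞) < (c e).1}, φ e j := by
  simp_rw [PointSeq.tsum_eq_tsum_ite]
  refine Measurable.tsum fun j => Measurable.ite ?_ (hφ j) measurable_const
  exact (measurable_fst.comp hc) (show MeasurableSet {n : ℕ∞ | (j : ℕ∞) < n} from trivial)

lemma IsHPPP.measurable_count {Ω : Type*} [MeasurableSpace Ω] {P : Measure Ω}
    {lam : ℝ≥0} {Φ : Ω → PointSeq} (hΦ : IsHPPP lam Φ P) {A : Set Plane} (hA : MeasurableSet A) :
    Measurable fun ω => (((Φ ω).count A : ℕ∞) : ℝ≥0∞) := by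
  simp_rw [← PointSeq.toMeasure_apply _ hA, ← lintegral_indicator_one hA,
    PointSeq.lintegral_toMeasure]
  refine measurable_tsum_points (φ := fun ω j => A.indicator 1 ((Φ ω).2 j)) (fun j => ?_)
    hΦ.measurable
  exact (measurable_one.indicator hA).comp
    ((measurable_pi_apply j).comp (measurable_snd.comp hΦ.measurable))

/-- The Laplace functional of a Poisson process at a simple function of bounded support. -/
lemma IsHPPP.lintegral_expNeg_simpleFunc {Ω : Type*} [MeasurableSpace Ω] {P : Measure Ω}
    {lam : ℝ≥0} {Φ : Ω → PointSeq} (hΦ : IsHPPP lam Φ P) (φ : SimpleFunc Plane ℝ≥0∞)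
    (hφ : Bornology.IsBounded {x | φ x ≠ 0}) :
    ∫⁻ ω, expNeg (∫⁻ x, φ x ∂(Φ ω).toMeasure) ∂P =
      expNeg (lam * ∫⁻ x, (1 - expNeg (φ x))) := by
  classical
  -- The value `0` is dropped: it contributes nothing, and its level set is unbounded, so its count
  -- is not covered by `IsHPPP`. The other level sets are bounded and disjoint, hence have
  -- independent counts.
  let s : Finset ℝ≥0∞ := φ.range.filter (· ≠ 0)
  let e := s.equivFin
  let B : ℝ≥0∞ → Set Plane := fun y => φ ⁻¹' {y}
  have hB : ∀ y, MeasurableSet (B y) := fun y => φ.measurableSet_fiber y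
  have hBb : ∀ y : s, Bornology.IsBounded (B y) := fun y => hφ.subset fun x hx => by
    have hx' : φ x = y := hx
    have := (Finset.mem_filter.1 y.2).2
    simpa [hx'] using this
  have hind := hΦ.iIndepFun_count s.card (fun i => B (e.symm i)) (fun i => hB _) (fun i => hBb _)
    (fun i j hij => Disjoint.preimage _ (Set.disjoint_singleton.2 fun h =>
      hij (e.symm.injective (Subtype.ext h))))
  have hind2 := hind.comp (fun i n => expNeg ((e.symm i : ℝ≥0∞) * ((n : ℕ∞) : ℝ≥0∞)))
    (fun i => measurable_from_top)
  have h1 : ∀ ω, expNeg (∫⁻ x, φ x ∂(Φ ω).toMeasure) =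
      ∏ i : Fin s.card, expNeg ((e.symm i : ℝ≥0∞) * ((Φ ω).count (B (e.symm i)) : ℕ∞)) := by
    intro ω
    rw [← expNeg_sum, SimpleFunc.lintegral_eq_lintegral, SimpleFunc.lintegral]
    congr 1
    rw [Equiv.sum_comp e.symm
      (fun y : s => (y : ℝ≥0∞) * (((Φ ω).count (B y) : ℕ∞) : ℝ≥0∞)),
      Finset.sum_coe_sort s (fun y => y * (((Φ ω).count (B y) : ℕ∞) : ℝ≥0∞)),
      Finset.sum_filter]
    refine Finset.sum_congr rfl fun y _ => ?_
    rw [PointSeq.toMeasure_apply _ (hB y)]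
    split_ifs with h
    · rfl
    · simp [not_not.1 h]
  simp_rw [h1]
  have h2 := lintegral_prod_eq_prod_lintegral_of_indepFun Finset.univ _ hind2
    (fun i => measurable_expNeg.comp ((hΦ.measurable_count (hB _)).const_mul _))
  simp only [Function.comp_apply] at h2
  rw [h2]
  simp_rw [fun i => hΦ.lintegral_expNeg_mul_count (hB (e.symm i)) (hBb _) (e.symm i : ℝ≥0∞)]
  rw [← expNeg_sum, ← Finset.mul_sum]
  congr 2
  have h3 : ∫⁻ x, (1 - expNeg (φ x)) = (φ.map fun y => 1 - expNeg y).lintegral volume :=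
    SimpleFunc.lintegral_eq_lintegral (φ.map fun y => 1 - expNeg y) volume
  rw [h3, SimpleFunc.map_lintegral, Equiv.sum_comp e.symm
      (fun y : s => (1 - expNeg (y : ℝ≥0∞)) * volume (B y)),
      Finset.sum_coe_sort s (fun y => (1 - expNeg y) * volume (B y)), Finset.sum_filter]
  refine Finset.sum_congr rfl fun y _ => ?_
  split_ifs with h
  · rfl
  · simp [not_not.1 h]

/-- The Laplace functional of a Poisson process. -/
lemma IsHPPP.lintegral_expNeg {Ω : Type*} [MeasurableSpace Ω] {P : Measure Ω}
    [IsProbabilityMeasure P] {lam : ℝ≥0} {Φ : Ω → PointSeq} (hΦ : IsHPPP lam Φ P)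
    {φ : Plane → ℝ≥0∞} (hφ : Measurable φ) :
    ∫⁻ ω, expNeg (∑' j : {j : ℕ // (j : ℕ∞) < (Φ ω).1}, φ ((Φ ω).2 j)) ∂P =
      expNeg (lam * ∫⁻ x, (1 - expNeg (φ x))) := by
  -- Simple approximations cut off to growing balls: they increase to `φ` and have bounded support.
  let ψ : ℕ → SimpleFunc Plane ℝ≥0∞ := fun n =>
    (SimpleFunc.eapprox φ n).restrict (Metric.ball 0 n)
  have hψ : ∀ n x, ψ n x = (Metric.ball (0 : Plane) n).indicator (SimpleFunc.eapprox φ n) x :=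
    fun n x => by rw [SimpleFunc.restrict_apply _ measurableSet_ball]
  have hmono : Monotone fun n x => ψ n x := by
    intro m n hmn x
    simp only [hψ]
    exact (Set.indicator_le_indicator_of_subset (Metric.ball_subset_ball (by exact_mod_cast hmn))
      (fun _ => zero_le) x).trans (Set.indicator_le_indicator (SimpleFunc.monotone_eapprox φ hmn x))
  have hlim : ∀ x, Tendsto (fun n => ψ n x) atTop (𝓝 (φ x)) := by
    intro x
    refine (SimpleFunc.tendsto_eapprox hφ x).congr' ?_
    obtain ⟨N, hN⟩ := exists_nat_gt ‖x‖
    filter_upwards [eventually_ge_atTop N] with n hn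
    rw [hψ, Set.indicator_of_mem]
    rw [mem_ball_zero_iff]
    exact hN.trans_le (by exact_mod_cast hn)
  have hbdd : ∀ n, Bornology.IsBounded {x | ψ n x ≠ 0} := fun n =>
    Metric.isBounded_ball.subset fun x hx => by
      by_contra h
      exact hx (by rw [hψ, Set.indicator_of_notMem h])
  have h1 := fun n => hΦ.lintegral_expNeg_simpleFunc (ψ n) (hbdd n)
  have hL : Tendsto (fun n => ∫⁻ ω, expNeg (∫⁻ x, ψ n x ∂(Φ ω).toMeasure) ∂P) atTop
      (𝓝 (∫⁻ ω, expNeg (∑' j : {j : ℕ // (j : ℕ∞) < (Φ ω).1}, φ ((Φ ω).2 j)) ∂P)) := by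
    refine tendsto_lintegral_of_dominated_convergence (fun _ => 1) (fun n => ?_)
      (fun n => Eventually.of_forall fun ω => expNeg_le_one _) (by simp)
      (Eventually.of_forall fun ω => ?_)
    · simp_rw [PointSeq.lintegral_toMeasure]
      refine measurable_expNeg.comp
        (measurable_tsum_points (φ := fun ω j => ψ n ((Φ ω).2 j)) (fun j => ?_) hΦ.measurable)
      exact (ψ n).measurable.comp ((measurable_pi_apply j).comp
        (measurable_snd.comp hΦ.measurable))
    · refine (continuous_expNeg.tendsto _).comp ?_
      rw [← PointSeq.lintegral_toMeasure]
      exact lintegral_tendsto_of_tendsto_of_monotone (fun n => (ψ n).measurable.aemeasurable)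
        (Eventually.of_forall fun x m n hmn => hmono hmn x) (Eventually.of_forall hlim)
  -- `1 - exp (-φ)` increases with `φ`, so monotone convergence applies even when the limiting
  -- integral is infinite.
  have hR : Tendsto (fun n => expNeg (lam * ∫⁻ x, (1 - expNeg (ψ n x)))) atTop
      (𝓝 (expNeg (lam * ∫⁻ x, (1 - expNeg (φ x))))) := by
    refine (continuous_expNeg.tendsto _).comp
      (ENNReal.Tendsto.const_mul ?_ (Or.inr ENNReal.coe_ne_top))
    refine lintegral_tendsto_of_tendsto_of_monotone
      (fun n => (measurable_const.sub (measurable_expNeg.comp (ψ n).measurable)).aemeasurable)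
      (Eventually.of_forall fun x m n hmn => ?_) (Eventually.of_forall fun x => ?_)
    · exact tsub_le_tsub_left (antitone_expNeg (hmono hmn x)) 1
    · exact ENNReal.Tendsto.sub tendsto_const_nhds ((continuous_expNeg.tendsto _).comp (hlim x))
        (Or.inl ENNReal.one_ne_top)
  simp_rw [h1] at hL
  exact tendsto_nhds_unique hL hR

/-! ### The Laplace transform of the interference -/

lemma measurable_receivedPower (α : ℝ) (b : Plane) :
    Measurable fun p : PointSeq × (ℕ → ℝ) => receivedPower α b p.1 p.2 := by
  unfold receivedPower
  refine measurable_tsum_points (c := Prod.fst)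
    (φ := fun (p : PointSeq × (ℕ → ℝ)) j =>
      ENNReal.ofReal (p.2 j) * edist (p.1.2 j) b ^ (-α)) (fun j => ?_) measurable_fst
  fun_prop

/-- Averaging over the fading gains of a fixed set of points. -/
lemma IsExpFading.lintegral_expNeg_receivedPower {Ω : Type*} [MeasurableSpace Ω] {P : Measure Ω}
    [IsProbabilityMeasure P] {f : Ω → ℕ → ℝ} (hf : IsExpFading f P) (α : ℝ) (b : Plane)
    (t : ℝ≥0∞) (c : PointSeq) :
    ∫⁻ ω, expNeg (t * receivedPower α b c (f ω)) ∂P =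
      expNeg (∑' j : {j : ℕ // (j : ℕ∞) < c.1}, logOneAdd (t * edist (c.2 j) b ^ (-α))) := by
  -- Extension by zero past the last point; the identity is proved for partial sums over `ℕ` and
  -- passed to the limit.
  let a : ℕ → ℝ≥0∞ := fun j => if (j : ℕ∞) < c.1 then t * edist (c.2 j) b ^ (-α) else 0
  have hl0 : logOneAdd 0 = 0 := by simp [logOneAdd]
  have h1 : ∀ ω, t * receivedPower α b c (f ω) = ∑' j : ℕ, ENNReal.ofReal (f ω j) * a j := by
    intro ω
    rw [receivedPower, c.tsum_eq_tsum_ite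
      (fun j => ENNReal.ofReal (f ω j) * edist (c.2 j) b ^ (-α)), ← ENNReal.tsum_mul_left]
    refine tsum_congr fun j => ?_
    simp only [a]
    split_ifs
    · ring
    · simp
  have h2 : ∑' j : {j : ℕ // (j : ℕ∞) < c.1}, logOneAdd (t * edist (c.2 j) b ^ (-α)) =
      ∑' j : ℕ, logOneAdd (a j) := by
    rw [c.tsum_eq_tsum_ite (fun j => logOneAdd (t * edist (c.2 j) b ^ (-α)))]
    refine tsum_congr fun j => ?_
    simp only [a]
    split_ifs
    · rfl
    · exact hl0.symm
  simp_rw [h1, h2]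
  have hfm : ∀ j, Measurable fun ω => f ω j := fun j => (measurable_pi_apply j).comp hf.measurable
  have hgm : ∀ j, Measurable fun x : ℝ => expNeg (ENNReal.ofReal x * a j) := fun j =>
    measurable_expNeg.comp (ENNReal.measurable_ofReal.mul_const _)
  have h3 : ∀ n, ∫⁻ ω, expNeg (∑ j ∈ Finset.range n, ENNReal.ofReal (f ω j) * a j) ∂P =
      expNeg (∑ j ∈ Finset.range n, logOneAdd (a j)) := by
    intro n
    simp_rw [expNeg_sum]
    have h4 := lintegral_prod_eq_prod_lintegral_of_indepFun (Finset.range n) _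
      (hf.iIndepFun.comp (fun j x => expNeg (ENNReal.ofReal x * a j)) hgm)
      (fun j => (hgm j).comp (hfm j))
    simp only [Function.comp_apply] at h4
    rw [h4]
    refine Finset.prod_congr rfl fun j _ => ?_
    rw [expNeg_logOneAdd, ← lintegral_expNeg_expMeasure,
      (hf.hasLaw j).lintegral_comp (hgm j).aemeasurable]
  have hL : Tendsto (fun n => ∫⁻ ω, expNeg (∑ j ∈ Finset.range n, ENNReal.ofReal (f ω j) * a j) ∂P)
      atTop (𝓝 (∫⁻ ω, expNeg (∑' j : ℕ, ENNReal.ofReal (f ω j) * a j) ∂P)) := by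
    refine tendsto_lintegral_of_dominated_convergence (fun _ => 1) (fun n => ?_)
      (fun n => Eventually.of_forall fun ω => expNeg_le_one _) (by simp)
      (Eventually.of_forall fun ω => ?_)
    · exact measurable_expNeg.comp (Finset.measurable_fun_sum _ fun j _ =>
        (hfm j).ennreal_ofReal.mul_const _)
    · exact (continuous_expNeg.tendsto _).comp ENNReal.summable.hasSum.tendsto_sum_nat
  simp_rw [h3] at hL
  exact tendsto_nhds_unique hL
    ((continuous_expNeg.tendsto _).comp ENNReal.summable.hasSum.tendsto_sum_nat)

/-- Tonelli for a product law, stated on `Ω` itself: one variable can be frozen while an independent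
one is averaged. -/
lemma lintegral_comp_prodMk_of_indepFun {Ω β γ : Type*} [MeasurableSpace Ω] [MeasurableSpace β]
    [MeasurableSpace γ] {P : Measure Ω} [IsProbabilityMeasure P] {X : Ω → β} {Y : Ω → γ}
    (hX : Measurable X) (hY : Measurable Y) (h : IndepFun X Y P) {F : β × γ → ℝ≥0∞}
    (hF : Measurable F) :
    ∫⁻ ω, F (X ω, Y ω) ∂P = ∫⁻ ω, ∫⁻ ω', F (X ω, Y ω') ∂P ∂P := by
  rw [← lintegral_map hF (hX.prodMk hY),
    (indepFun_iff_map_prod_eq_prod_map_map hX.aemeasurable hY.aemeasurable).1 h,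
    lintegral_prod _ hF.aemeasurable, lintegral_map hF.lintegral_prod_right' hX]
  congr with ω
  exact lintegral_map (hF.comp measurable_prodMk_left) hY

/-- The Laplace transform of the interference of a Poisson field of transmitters. -/
lemma lintegral_expNeg_receivedPower {Ω : Type*} [MeasurableSpace Ω] {P : Measure Ω}
    [IsProbabilityMeasure P] {lam : ℝ≥0} {Φ : Ω → PointSeq} (hΦ : IsHPPP lam Φ P)
    {f : Ω → ℕ → ℝ} (hf : IsExpFading f P) (hind : IndepFun Φ f P) {α : ℝ} (hα : 2 < α)
    (b : Plane) {s : ℝ} (hs : 0 ≤ s) :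
    ∫⁻ ω, expNeg (ENNReal.ofReal s * receivedPower α b (Φ ω) (f ω)) ∂P =
      expNeg (lam * ENNReal.ofReal (Real.pi * s ^ (2 / α) *
        ((2 * Real.pi / α) / Real.sin (2 * Real.pi / α)))) := by
  have hm : Measurable fun p : PointSeq × (ℕ → ℝ) =>
      expNeg (ENNReal.ofReal s * receivedPower α b p.1 p.2) :=
    measurable_expNeg.comp ((measurable_receivedPower α b).const_mul _)
  rw [lintegral_comp_prodMk_of_indepFun hΦ.measurable hf.measurable hind hm]
  simp_rw [hf.lintegral_expNeg_receivedPower]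
  -- With the gains averaged out, what remains is a Laplace functional of `Φ` at `log (1 + s
  -- r^(-α))`.
  have hφ : Measurable fun x : Plane => logOneAdd (ENNReal.ofReal s * edist x b ^ (-α)) :=
    measurable_logOneAdd.comp (by fun_prop)
  rw [hΦ.lintegral_expNeg hφ]
  simp_rw [expNeg_logOneAdd]
  rw [lintegral_one_sub_inv_one_add_path_loss hα hs]

/-! ### The decoding probability given the source location -/

/-- Disjoint blocks of an independent family generate independent σ-algebras; this supplies every
pairwise independence between groups of the six random objects. -/
lemma indepFun_of_iIndep {Ω ι β γ : Type*} [MeasurableSpace Ω] [mβ : MeasurableSpace β]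
    [mγ : MeasurableSpace γ] {P : Measure Ω} {m : ι → MeasurableSpace Ω} (hm : iIndep m P)
    (hle : ∀ i, m i ≤ ‹MeasurableSpace Ω›) {S T : Set ι} (hST : Disjoint S T) {X : Ω → β}
    {Y : Ω → γ} (hX : Measurable[⨆ i ∈ S, m i] X) (hY : Measurable[⨆ i ∈ T, m i] Y) :
    IndepFun X Y P :=
  indep_of_indep_of_le_left (indep_of_indep_of_le_right (indep_iSup_of_disjoint hle hm hST)
    (measurable_iff_comap_le.1 hY)) (measurable_iff_comap_le.1 hX)

/-- The probability that an exponential signal exceeds the threshold, given its distance `d` and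
the interference `D`. -/
lemma expMeasure_setOf_le_div {τ α d : ℝ} (hτ : 0 < τ) (hd : 0 < d) (D : ℝ≥0∞) :
    expMeasure 1 {x | ENNReal.ofReal τ ≤ ENNReal.ofReal x * ENNReal.ofReal d ^ (-α) / D} =
      expNeg (ENNReal.ofReal (τ * d ^ α) * D) := by
  rw [← expMeasure_setOf_le_ofReal]
  -- A nonzero signal is needed when `D = 0`: `0 / 0 = 0` would fail the threshold although `0 ≤ 0`
  -- holds.
  have hae : ∀ᵐ x ∂(expMeasure 1), ENNReal.ofReal x ≠ 0 := by
    rw [ae_iff]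
    simpa using expMeasure_setOf_ofReal_eq_zero
  apply measure_congr
  filter_upwards [hae] with x hx
  apply propext
  change ENNReal.ofReal τ ≤ ENNReal.ofReal x * ENNReal.ofReal d ^ (-α) / D ↔
    ENNReal.ofReal (τ * d ^ α) * D ≤ ENNReal.ofReal x
  have hd0 : ENNReal.ofReal d ^ α ≠ 0 := by
    rw [ENNReal.ofReal_rpow_of_pos hd]; exact (ENNReal.ofReal_pos.2 (by positivity)).ne'
  have hdt : ENNReal.ofReal d ^ α ≠ ⊤ := by
    rw [ENNReal.ofReal_rpow_of_pos hd]; exact ENNReal.ofReal_ne_top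
  rw [ENNReal.rpow_neg, ENNReal.ofReal_mul hτ.le, ← ENNReal.ofReal_rpow_of_pos hd]
  by_cases hD : D = ⊤
  · subst hD
    simp [ENNReal.mul_top, hd0, hτ]
  have hnum : ENNReal.ofReal x * (ENNReal.ofReal d ^ α)⁻¹ ≠ 0 :=
    mul_ne_zero hx (ENNReal.inv_ne_zero.2 hdt)
  rw [ENNReal.le_div_iff_mul_le (Or.inr hnum) (Or.inl hD), ← div_eq_mul_inv,
    ENNReal.le_div_iff_mul_le (Or.inl hd0) (Or.inl hdt), mul_right_comm]

lemma measurable_iSup_of_mem {Ω ι β : Type*} [MeasurableSpace β] {m : ι → MeasurableSpace Ω}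
    {S : Set ι} {i : ι} (hi : i ∈ S) {X : Ω → β} (hX : Measurable[m i] X) :
    Measurable[⨆ i ∈ S, m i] X :=
  hX.mono (le_iSup₂ (f := fun i (_ : i ∈ S) => m i) i hi) le_rfl

lemma sin_two_pi_div_pos {α : ℝ} (hα : 2 < α) : 0 < Real.sin (2 * Real.pi / α) := by
  have hp := Real.pi_pos
  refine Real.sin_pos_of_pos_of_lt_pi (by positivity) ?_
  rw [div_lt_iff₀ (by linarith)]
  nlinarith

lemma psiCoeff_nonneg {α τ : ℝ} (hα : 2 < α) (hτ : 0 < τ) (lam lamI PI : ℝ≥0) :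
    0 ≤ psiCoeff α τ lam lamI PI := by
  have := sin_two_pi_div_pos hα
  have := Real.pi_pos
  unfold psiCoeff epsCoeff
  positivity

/-- The product of the Laplace transforms of the two interference fields. -/
lemma expNeg_mul_expNeg_eq_psiCoeff {α τ d : ℝ} (hα : 2 < α) (hτ : 0 < τ) (hd : 0 ≤ d)
    (lam lamI PI : ℝ≥0) :
    expNeg (lam * ENNReal.ofReal (Real.pi * (τ * d ^ α) ^ (2 / α) *
        ((2 * Real.pi / α) / Real.sin (2 * Real.pi / α)))) *
      expNeg (lamI * ENNReal.ofReal (Real.pi * (τ * d ^ α * PI) ^ (2 / α) *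
        ((2 * Real.pi / α) / Real.sin (2 * Real.pi / α)))) =
      expNeg (ENNReal.ofReal (psiCoeff α τ lam lamI PI * d ^ 2)) := by
  have hsin := sin_two_pi_div_pos hα
  have hpi := Real.pi_pos
  -- The path-loss exponent cancels, which is why the final exponent is quadratic in the distance.
  have h1 : (d ^ α) ^ (2 / α) = d ^ 2 := by
    rw [← Real.rpow_mul hd, mul_div_cancel₀ _ (by linarith), Real.rpow_two]
  rw [← expNeg_add, ← ENNReal.ofReal_coe_nnreal (p := lam), ← ENNReal.ofReal_coe_nnreal (p := lamI),
    ← ENNReal.ofReal_mul (by positivity), ← ENNReal.ofReal_mul (by positivity),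
    ← ENNReal.ofReal_add (by positivity) (by positivity)]
  congr 2
  rw [Real.mul_rpow (x := τ * d ^ α) (by positivity) (by positivity),
    Real.mul_rpow hτ.le (by positivity), h1, psiCoeff, epsCoeff]
  ring

/-- The decoding probability as an average over the location of the source. -/
lemma measure_le_sinr {Ω : Type*} [MeasurableSpace Ω] (P : Measure Ω) [IsProbabilityMeasure P]
    {α τ : ℝ} (hα : 2 < α) (hτ : 0 < τ) {lam lamI : ℝ≥0} (PN PI : ℝ≥0) (b : Plane)
    {U : Ω → Plane} (hU : Measurable U) (hUb : ∀ᵐ ω ∂P, U ω ≠ b)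
    {h : Ω → ℝ} (hh : Measurable h) (hhlaw : HasLaw h (expMeasure 1) P)
    {Φ ΦI : Ω → PointSeq} (hΦ : IsHPPP lam Φ P) (hΦI : IsHPPP lamI ΦI P)
    {f g : Ω → ℕ → ℝ} (hf : IsExpFading f P) (hg : IsExpFading g P)
    (hindep : iIndep ![MeasurableSpace.comap U inferInstance, MeasurableSpace.comap h inferInstance,
      MeasurableSpace.comap Φ inferInstance, MeasurableSpace.comap f inferInstance,
      MeasurableSpace.comap ΦI inferInstance, MeasurableSpace.comap g inferInstance] P) :
    P {ω | ENNReal.ofReal τ ≤ sinr α PN PI b (U ω) (h ω) (Φ ω) (f ω) (ΦI ω) (g ω)} =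
      ∫⁻ u, expNeg (ENNReal.ofReal (τ * dist u b ^ α) * PN) *
        expNeg (ENNReal.ofReal (psiCoeff α τ lam lamI PI * dist u b ^ 2)) ∂(P.map U) := by
  have hle : ∀ i, ![MeasurableSpace.comap U inferInstance, MeasurableSpace.comap h inferInstance,
      MeasurableSpace.comap Φ inferInstance, MeasurableSpace.comap f inferInstance,
      MeasurableSpace.comap ΦI inferInstance, MeasurableSpace.comap g inferInstance] i ≤
      ‹MeasurableSpace Ω› := by
    intro i
    fin_cases i
    exacts [hU.comap_le, hh.comap_le, hΦ.measurable.comap_le, hf.measurable.comap_le,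
      hΦI.measurable.comap_le, hg.measurable.comap_le]
  let m := ![MeasurableSpace.comap U inferInstance, MeasurableSpace.comap h inferInstance,
      MeasurableSpace.comap Φ inferInstance, MeasurableSpace.comap f inferInstance,
      MeasurableSpace.comap ΦI inferInstance, MeasurableSpace.comap g inferInstance]
  have mU : Measurable[m 0] U := comap_measurable U
  have mh : Measurable[m 1] h := comap_measurable h
  have mΦ : Measurable[m 2] Φ := comap_measurable Φ
  have mf : Measurable[m 3] f := comap_measurable f
  have mΦI : Measurable[m 4] ΦI := comap_measurable ΦI
  have mg : Measurable[m 5] g := comap_measurable g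
  -- All of the interference data in one variable, so that `h` is averaged with `(U, W)` frozen,
  -- then `W` with `U` frozen.
  let W : Ω → (PointSeq × (ℕ → ℝ)) × (PointSeq × (ℕ → ℝ)) :=
    fun ω => ((Φ ω, f ω), (ΦI ω, g ω))
  have hW : Measurable W :=
    (hΦ.measurable.prodMk hf.measurable).prodMk (hΦI.measurable.prodMk hg.measurable)
  have ind_h : IndepFun (fun ω => (U ω, W ω)) h P :=
    indepFun_of_iIndep hindep hle (S := {0, 2, 3, 4, 5}) (T := {1}) (by simp)
      ((measurable_iSup_of_mem (by simp) mU).prodMk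
        (((measurable_iSup_of_mem (by simp) mΦ).prodMk
          (measurable_iSup_of_mem (by simp) mf)).prodMk
        ((measurable_iSup_of_mem (by simp) mΦI).prodMk (measurable_iSup_of_mem (by simp) mg))))
      (measurable_iSup_of_mem (by simp) mh)
  have ind_U : IndepFun U W P :=
    indepFun_of_iIndep hindep hle (S := {0}) (T := {2, 3, 4, 5}) (by simp)
      (measurable_iSup_of_mem (by simp) mU)
      (((measurable_iSup_of_mem (by simp) mΦ).prodMk
          (measurable_iSup_of_mem (by simp) mf)).prodMk
        ((measurable_iSup_of_mem (by simp) mΦI).prodMk (measurable_iSup_of_mem (by simp) mg)))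
  have ind_W : IndepFun (fun ω => (Φ ω, f ω)) (fun ω => (ΦI ω, g ω)) P :=
    indepFun_of_iIndep hindep hle (S := {2, 3}) (T := {4, 5}) (by simp)
      ((measurable_iSup_of_mem (by simp) mΦ).prodMk (measurable_iSup_of_mem (by simp) mf))
      ((measurable_iSup_of_mem (by simp) mΦI).prodMk (measurable_iSup_of_mem (by simp) mg))
  have ind_Φ : IndepFun Φ f P :=
    indepFun_of_iIndep hindep hle (S := {2}) (T := {3}) (by simp)
      (measurable_iSup_of_mem (by simp) mΦ) (measurable_iSup_of_mem (by simp) mf)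
  have ind_ΦI : IndepFun ΦI g P :=
    indepFun_of_iIndep hindep hle (S := {4}) (T := {5}) (by simp)
      (measurable_iSup_of_mem (by simp) mΦI) (measurable_iSup_of_mem (by simp) mg)
  have hR := measurable_receivedPower α b
  let D : (PointSeq × (ℕ → ℝ)) × (PointSeq × (ℕ → ℝ)) → ℝ≥0∞ := fun w =>
    PN + receivedPower α b w.1.1 w.1.2 + PI * receivedPower α b w.2.1 w.2.2
  have hD : Measurable D :=
    ((hR.comp measurable_fst).const_add _).add ((hR.comp measurable_snd).const_mul _)
  let S : Set ((Plane × ((PointSeq × (ℕ → ℝ)) × (PointSeq × (ℕ → ℝ)))) × ℝ) :=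
    {p | ENNReal.ofReal τ ≤ ENNReal.ofReal p.2 * edist p.1.1 b ^ (-α) / D p.1.2}
  have hS : MeasurableSet S := by
    refine measurableSet_le measurable_const (Measurable.div ?_ ?_)
    · fun_prop
    · exact hD.comp (measurable_snd.comp measurable_fst)
  have step_h : ∀ᵐ ω ∂P, ∫⁻ ω', S.indicator 1 ((U ω, W ω), h ω') ∂P =
      expNeg (ENNReal.ofReal (τ * dist (U ω) b ^ α) * D (W ω)) := by
    filter_upwards [hUb] with ω hω
    rw [← expMeasure_setOf_le_div hτ (dist_pos.2 hω), ← edist_dist]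
    have hS' : MeasurableSet (Prod.mk (U ω, W ω) ⁻¹' S) := measurable_prodMk_left hS
    rw [hhlaw.lintegral_comp (f := fun x => S.indicator 1 ((U ω, W ω), x))
      ((measurable_one.indicator hS).comp measurable_prodMk_left).aemeasurable]
    exact lintegral_indicator_one hS'
  have hG : Measurable fun p : Plane × ((PointSeq × (ℕ → ℝ)) × (PointSeq × (ℕ → ℝ))) =>
      expNeg (ENNReal.ofReal (τ * dist p.1 b ^ α) * D p.2) := by
    refine measurable_expNeg.comp (Measurable.mul ?_ (hD.comp measurable_snd))
    have : Measurable fun p : Plane × ((PointSeq × (ℕ → ℝ)) × (PointSeq × (ℕ → ℝ))) =>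
      dist p.1 b := measurable_fst.dist measurable_const
    fun_prop
  -- To be used at `s = τ d^α`; the relative power `PI` is absorbed into the transform variable of
  -- the incumbent field.
  have step_W : ∀ s : ℝ, 0 ≤ s → ∫⁻ ω, expNeg (ENNReal.ofReal s * D (W ω)) ∂P =
      expNeg (ENNReal.ofReal s * PN) *
        (expNeg (lam * ENNReal.ofReal (Real.pi * s ^ (2 / α) *
          ((2 * Real.pi / α) / Real.sin (2 * Real.pi / α)))) *
        expNeg (lamI * ENNReal.ofReal (Real.pi * (s * PI) ^ (2 / α) *
          ((2 * Real.pi / α) / Real.sin (2 * Real.pi / α))))) := by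
    intro s hs
    have hs' : 0 ≤ s * PI := by positivity
    rw [← lintegral_expNeg_receivedPower hΦ hf ind_Φ hα b hs,
      ← lintegral_expNeg_receivedPower hΦI hg ind_ΦI hα b hs']
    have hm : ∀ t : ℝ≥0∞, Measurable fun p : PointSeq × (ℕ → ℝ) =>
        expNeg (t * receivedPower α b p.1 p.2) := fun t =>
      measurable_expNeg.comp (hR.const_mul t)
    have hprod := lintegral_mul_eq_lintegral_mul_lintegral_of_indepFun''
      ((hm (ENNReal.ofReal s)).comp (hΦ.measurable.prodMk hf.measurable)).aemeasurable
      ((hm (ENNReal.ofReal (s * PI))).comp (hΦI.measurable.prodMk hg.measurable)).aemeasurable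
      (ind_W.comp (hm (ENNReal.ofReal s)) (hm (ENNReal.ofReal (s * PI))))
    simp only [Function.comp_apply] at hprod
    rw [← hprod, ← lintegral_const_mul' _ _ (expNeg_ne_top _)]
    refine lintegral_congr fun ω => ?_
    rw [← expNeg_add, ← expNeg_add, ENNReal.ofReal_mul hs, ENNReal.ofReal_coe_nnreal]
    congr 1
    simp only [D, W]
    ring
  calc P {ω | ENNReal.ofReal τ ≤ sinr α PN PI b (U ω) (h ω) (Φ ω) (f ω) (ΦI ω) (g ω)}
      = ∫⁻ ω, S.indicator 1 ((U ω, W ω), h ω) ∂P :=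
        (lintegral_indicator_one (((hU.prodMk hW).prodMk hh) hS)).symm
    _ = ∫⁻ ω, ∫⁻ ω', S.indicator 1 ((U ω, W ω), h ω') ∂P ∂P :=
        lintegral_comp_prodMk_of_indepFun (hU.prodMk hW) hh ind_h (measurable_one.indicator hS)
    _ = ∫⁻ ω, expNeg (ENNReal.ofReal (τ * dist (U ω) b ^ α) * D (W ω)) ∂P :=
        lintegral_congr_ae step_h
    _ = ∫⁻ ω, ∫⁻ ω', expNeg (ENNReal.ofReal (τ * dist (U ω) b ^ α) * D (W ω')) ∂P ∂P :=
        lintegral_comp_prodMk_of_indepFun hU hW ind_U hG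
    _ = ∫⁻ ω, expNeg (ENNReal.ofReal (τ * dist (U ω) b ^ α) * PN) *
        expNeg (ENNReal.ofReal (psiCoeff α τ lam lamI PI * dist (U ω) b ^ 2)) ∂P := by
        refine lintegral_congr fun ω => ?_
        rw [step_W _ (by positivity), expNeg_mul_expNeg_eq_psiCoeff hα hτ dist_nonneg]
    _ = _ := by
        refine (lintegral_map (f := fun u => expNeg (ENNReal.ofReal (τ * dist u b ^ α) * PN) *
          expNeg (ENNReal.ofReal (psiCoeff α τ lam lamI PI * dist u b ^ 2))) ?_ hU).symm
        have hd : Measurable fun u : Plane => dist u b := measurable_id.dist measurable_const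
        exact (measurable_expNeg.comp (by fun_prop)).mul (measurable_expNeg.comp (by fun_prop))

/-! ### Averaging over the source and vanishing noise -/

/-- The noiseless average in polar coordinates. -/
lemma lintegral_cond_expNeg_eq_polarRegion {ψ : ℝ} (hψ : 0 ≤ ψ) {A : Set Plane}
    (hA : MeasurableSet A) (hA0 : volume A ≠ 0) (hAtop : volume A ≠ ∞) (pb θb : ℝ) :
    ∫⁻ u, expNeg (ENNReal.ofReal (ψ * dist u (polarPoint pb θb) ^ 2))
        ∂(ProbabilityTheory.cond volume A) =
      ∫⁻ q in polarRegion A, ENNReal.ofReal (adpIntegrand ψ A pb θb q) := by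
  rw [ProbabilityTheory.cond, lintegral_smul_measure, lintegral_eq_polarRegion hA, smul_eq_mul,
    ← lintegral_const_mul' _ _ (ENNReal.inv_ne_top.2 hA0)]
  refine setLIntegral_congr_fun (measurableSet_polarRegion hA) fun q hq => ?_
  have hq0 : 0 < q.1 := hq.1
  have hv : 0 < volume.real A := ENNReal.toReal_pos hA0 hAtop
  rw [expNeg_ofReal (by positivity), dist_polarPoint_sq, adpIntegrand,
    ENNReal.ofReal_mul (Real.exp_pos _).le, ENNReal.ofReal_div_of_pos hv, neg_mul,
    Measure.real, ENNReal.ofReal_toReal hAtop, div_eq_mul_inv]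
  ring

theorem theorem2
    {Ω : Type*} [MeasurableSpace Ω] (P : Measure Ω) [IsProbabilityMeasure P]
    -- path-loss exponent, decoding threshold, densities, relative incumbent power
    (α τ : ℝ) (hα : 2 < α) (hτ : 0 < τ) (lam lamI PI : ℝ≥0)
    -- area
    (A : Set Plane) (hA : MeasurableSet A) (hA0 : volume A ≠ 0) (hAtop : volume A ≠ ∞)
    -- polar coordinates of the receiver
    (pb θb : ℝ) (hpb : 0 ≤ pb)
    -- source location and its fading gain
    (U : Ω → Plane) (hU : Measurable U) (hUunif : pdf.IsUniform U A P volume)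
    (h : Ω → ℝ) (hh : Measurable h) (hhlaw : HasLaw h (expMeasure 1) P)
    -- active IoT devices and incumbents, with their fading gains
    (Φ ΦI : Ω → PointSeq) (hΦ : IsHPPP lam Φ P) (hΦI : IsHPPP lamI ΦI P)
    (f g : Ω → ℕ → ℝ) (hf : IsExpFading f P) (hg : IsExpFading g P)
    -- the six random objects are independent
    (hindep : iIndep ![MeasurableSpace.comap U inferInstance, MeasurableSpace.comap h inferInstance,
      MeasurableSpace.comap Φ inferInstance, MeasurableSpace.comap f inferInstance,
      MeasurableSpace.comap ΦI inferInstance, MeasurableSpace.comap g inferInstance] P) :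
    -- law of cosines
    (∀ r θ : ℝ, dist (polarPoint r θ) (polarPoint pb θb) ^ 2 = cosineDistSq r θ pb θb) ∧
    -- the integral converges
    IntegrableOn (adpIntegrand (psiCoeff α τ lam lamI PI) A pb θb) (polarRegion A) ∧
    -- the formula without noise
    adp P α τ 0 PI (polarPoint pb θb) U h Φ f ΦI g =
      ∫ q in polarRegion A, adpIntegrand (psiCoeff α τ lam lamI PI) A pb θb q ∧
    -- the formula in the limit of vanishing noise power
    Tendsto (fun PN : ℝ≥0 => adp P α τ PN PI (polarPoint pb θb) U h Φ f ΦI g) (𝓝[>] 0)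
      (𝓝 (∫ q in polarRegion A, adpIntegrand (psiCoeff α τ lam lamI PI) A pb θb q)) := by
  set b := polarPoint pb θb with hb
  set ψ := psiCoeff α τ lam lamI PI
  have hψ : 0 ≤ ψ := psiCoeff_nonneg hα hτ lam lamI PI
  have hmap : P.map U = ProbabilityTheory.cond volume A := hUunif
  have hprob : IsProbabilityMeasure (ProbabilityTheory.cond volume A) :=
    hmap ▸ Measure.isProbabilityMeasure_map hU.aemeasurable
  -- The uniform law has no atoms, so the infinite path gain at distance `0` is almost surely
  -- avoided.
  have hUb : ∀ᵐ ω ∂P, U ω ≠ b := by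
    have : ∀ᵐ u ∂(P.map U), u ≠ b :=
      hUunif.absolutelyContinuous.ae_le (Measure.ae_ne volume b)
    exact ae_of_ae_map hU.aemeasurable this
  have hadp : ∀ PN : ℝ≥0, adp P α τ PN PI b U h Φ f ΦI g =
      (∫⁻ u, expNeg (ENNReal.ofReal (τ * dist u b ^ α) * PN) *
        expNeg (ENNReal.ofReal (ψ * dist u b ^ 2)) ∂(ProbabilityTheory.cond volume A)).toReal := by
    intro PN
    rw [adp, Measure.real, measure_le_sinr P hα hτ PN PI b hU hUb hh hhlaw hΦ hΦI hf hg hindep,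
      hmap]
  have hpolar := lintegral_cond_expNeg_eq_polarRegion hψ hA hA0 hAtop pb θb
  have hfin : ∫⁻ u, expNeg (ENNReal.ofReal (ψ * dist u b ^ 2))
      ∂(ProbabilityTheory.cond volume A) ≠ ⊤ := by
    refine ne_top_of_le_ne_top ENNReal.one_ne_top ?_
    refine (lintegral_mono fun u => expNeg_le_one _).trans ?_
    simp
  have hmeas : Measurable (adpIntegrand ψ A pb θb) := by
    unfold adpIntegrand cosineDistSq
    fun_prop
  have hnonneg : 0 ≤ᵐ[volume.restrict (polarRegion A)] adpIntegrand ψ A pb θb := by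
    filter_upwards [self_mem_ae_restrict (measurableSet_polarRegion hA)] with q hq
    have hq0 : 0 < q.1 := hq.1
    exact mul_nonneg (Real.exp_pos _).le (div_nonneg hq0.le measureReal_nonneg)
  have hintegral : ∫ q in polarRegion A, adpIntegrand ψ A pb θb q =
      (∫⁻ u, expNeg (ENNReal.ofReal (ψ * dist u b ^ 2))
        ∂(ProbabilityTheory.cond volume A)).toReal := by
    rw [hpolar, integral_eq_lintegral_of_nonneg_ae hnonneg hmeas.aestronglyMeasurable]
  refine ⟨fun r θ => dist_polarPoint_sq r θ pb θb, ⟨hmeas.aestronglyMeasurable, ?_⟩, ?_, ?_⟩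
  · rw [hasFiniteIntegral_iff_ofReal hnonneg, ← hpolar]
    exact hfin.lt_top
  · rw [hadp, hintegral]
    simp
  · rw [hintegral]
    simp_rw [hadp]
    refine (ENNReal.tendsto_toReal hfin).comp ?_
    have hd : Measurable fun u : Plane => dist u b := measurable_id.dist measurable_const
    refine tendsto_lintegral_filter_of_dominated_convergence (fun _ => 1)
      (Eventually.of_forall fun PN => ?_) (Eventually.of_forall fun PN => ?_) (by simp)
      (Eventually.of_forall fun u => ?_)
    · exact (measurable_expNeg.comp (by fun_prop)).mul (measurable_expNeg.comp (by fun_prop))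
    · exact Eventually.of_forall fun u => mul_le_one' (expNeg_le_one _) (expNeg_le_one _)
    -- At a fixed source location the coefficient `τ d^α` is finite, so the noise factor is
    -- continuous in `PN` with value `1` at `0`.
    · have hc : Tendsto (fun PN : ℝ≥0 => expNeg (ENNReal.ofReal (τ * dist u b ^ α) * PN))
          (𝓝[>] 0) (𝓝 1) := by
        have h0 : Continuous fun PN : ℝ≥0 =>
            expNeg (ENNReal.ofReal (τ * dist u b ^ α) * PN) :=
          continuous_expNeg.comp ((ENNReal.continuous_const_mul ENNReal.ofReal_ne_top).comp
            ENNReal.continuous_coe)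
        have := (h0.tendsto 0).mono_left (nhdsWithin_le_nhds (s := Set.Ioi 0))
        simpa using this
      have := ENNReal.Tendsto.mul_const (b := expNeg (ENNReal.ofReal (ψ * dist u b ^ 2))) hc
        (Or.inr (expNeg_ne_top _))
      simpa using this
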